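/- Let $r\ge 0$ and let $p_1,\dots,p_J$ be noncommutative $*$-polynomials, i.e. complex linear combinations of finitely many words in variables $x_1,\dots,x_r,y_1,y_2,\dots$ and their formal adjoints $x_1^*,\dots,x_r^*,y_1^*,y_2^*,\dots$. Suppose that for each $j$ there is an integer $d_j\ge 1$ such that $p_j$ is $d_j$-homogeneous in the first $r$ variables, meaning that $p_j(t\mathbf x,\mathbf y)=t^{d_j}\,p_j(\mathbf x,\mathbf y)$ for all real scalars $t$, where $\mathbf x=(x_1,\dots,x_r)$, $t\mathbf x=(tx_1,\dots,tx_r)$ and $\mathbf y=(y_1,y_2,\dots)$; in particular $p_j$ has no constant term. Let $C_1,\dots,C_J>0$ be constants. Let $A$ be a C*-algebra, not necessarily unital, let $I$ be a closed two-sided ideal of $A$, and let $\pi:A\to A/I$ be the quotient map. Then for all $x_1,\dots,x_r$ and $y_1,y_2,\dots$ in $A$ with $x_k\ge 0$ for $k=1,\dots,r$ and $$\bigl\|p_j\bigl(\pi(x_1),\dots,\pi(x_r),\pi(y_1),\pi(y_2),\dots\bigr)\bigr\|\le C_j\qquad(j=1,\dots,J),$$ there are $z_1,\dots,z_r$ in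 $A$ with $0\le z_k\le x_k$ and $\pi(z_k)=\pi(x_k)$ for $k=1,\dots,r$, and $$\bigl\|p_j(z_1,\dots,z_r,y_1,y_2,\dots)\bigr\|\le C_j\qquad(j=1,\dots,J).$$ -/

import Mathlib

/-! ### Closed two-sided ideals of a C*-algebra and the quotient `A / I` -/

/-- An ideal `I` of a (not necessarily unital) C*-algebra `A`: a norm-closed two-sided ideal, that
is, a closed complex subspace that absorbs products with elements of `A` on both sides. -/
structure CStarIdeal (A : Type*) [NonUnitalCStarAlgebra A] extends Submodule ℂ A where
  mul_mem_left' : ∀ (a : A) {b : A}, b ∈ carrier → a * b ∈ carrier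
  mul_mem_right' : ∀ {a : A} (b : A), a ∈ carrier → a * b ∈ carrier
  isClosed' : IsClosed carrier

namespace CStarIdeal

variable {A : Type*} [NonUnitalCStarAlgebra A]

/-- Auxiliary estimate: `a⋆` is approximated by `b * (k * a⋆)` where `b = a⋆ * a`. -/
theorem exists_approx (a : A) {δ : ℝ} (hδ : 0 < δ) :
    ∃ k : A, ‖star a - (star a * a) * (k * star a)‖ ^ 2 ≤ δ / 2 := by
  have hb : IsSelfAdjoint (star a * a) := IsSelfAdjoint.star_mul_self a
  set b := star a * a with hbdef
  let g : ℝ → ℝ := fun t => t / (t ^ 2 + δ ^ 2)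
  have hpos : ∀ t : ℝ, 0 < t ^ 2 + δ ^ 2 := fun t => by positivity
  have hg : Continuous g :=
    continuous_id.div (by fun_prop) (fun t => (hpos t).ne')
  let f : ℝ → ℝ := fun t => t * g t
  have hf : Continuous f := continuous_id.mul hg
  have hg0 : g 0 = 0 := by simp [g]
  have hf0 : f 0 = 0 := by simp [f]
  have hF : b * cfcₙ g b = cfcₙ f b := by
    rw [cfcₙ_mul (fun t => t) g b (by fun_prop) (by simp) hg.continuousOn hg0, cfcₙ_id' ℝ b]
  have hFb : cfcₙ f b * b = cfcₙ (fun t => f t * t) b := by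
    rw [cfcₙ_mul f (fun t => t) b hf.continuousOn hf0 (by fun_prop) (by simp), cfcₙ_id' ℝ b]
  have hFbF : cfcₙ f b * b * cfcₙ f b = cfcₙ (fun t => f t * t * f t) b := by
    rw [hFb, cfcₙ_mul (fun t => f t * t) f b (hf.mul continuous_id).continuousOn (by simp [hf0])
      hf.continuousOn hf0]
  have hbF : b * cfcₙ f b = cfcₙ (fun t => t * f t) b := by
    rw [cfcₙ_mul (fun t => t) f b (by fun_prop) (by simp) hf.continuousOn hf0, cfcₙ_id' ℝ b]
  have hFsa : star (cfcₙ f b) = cfcₙ f b := (IsSelfAdjoint.cfcₙ (f := f) (a := b)).star_eq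
  refine ⟨cfcₙ g b, ?_⟩
  rw [← mul_assoc, hF, sq, ← CStarRing.norm_self_mul_star]
  have hexp : (star a - cfcₙ f b * star a) * star (star a - cfcₙ f b * star a)
      = b - b * cfcₙ f b - (cfcₙ f b * b - cfcₙ f b * b * cfcₙ f b) := by
    generalize cfcₙ f b = F at hFsa
    simp only [star_sub, star_mul, star_star, hFsa, sub_mul, mul_sub, mul_assoc, hbdef]
    abel
  have hall : (star a - cfcₙ f b * star a) * star (star a - cfcₙ f b * star a)
      = cfcₙ (fun t => (t - t * f t) - (f t * t - f t * t * f t)) b := by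
    rw [hexp, hFbF, hFb, hbF,
      cfcₙ_sub (fun t => t - t * f t) (fun t => f t * t - f t * t * f t) b
        (by fun_prop) (by simp) (by fun_prop) (by simp [hf0]),
      cfcₙ_sub (fun t => t) (fun t => t * f t) b (by fun_prop) (by simp) (by fun_prop) (by simp),
      cfcₙ_sub (fun t => f t * t) (fun t => f t * t * f t) b
        (by fun_prop) (by simp [hf0]) (by fun_prop) (by simp [hf0]), cfcₙ_id' ℝ b]
  rw [hall]
  refine norm_cfcₙ_le fun t _ => ?_
  have h1 : (t - t * f t) - (f t * t - f t * t * f t) = t * (δ ^ 2 / (t ^ 2 + δ ^ 2)) ^ 2 := by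
    have := (hpos t).ne'
    simp only [f, g]
    field_simp
    ring
  rw [h1, Real.norm_eq_abs, abs_mul, abs_of_nonneg (by positivity :
    0 ≤ (δ ^ 2 / (t ^ 2 + δ ^ 2)) ^ 2), div_pow, ← mul_div_assoc,
    div_le_iff₀ (by have := hpos t; positivity)]
  have h2 : 2 * |t| * δ ≤ t ^ 2 + δ ^ 2 := by
    nlinarith [sq_nonneg (|t| - δ), sq_abs t]
  have h3 : δ ^ 2 ≤ t ^ 2 + δ ^ 2 := by nlinarith [sq_nonneg t]
  have h4 : (2 * |t| * δ) * δ ^ 2 ≤ (t ^ 2 + δ ^ 2) * (t ^ 2 + δ ^ 2) :=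
    mul_le_mul h2 h3 (by positivity) (by positivity)
  nlinarith

/-- A closed two-sided ideal of a C*-algebra is closed under the involution. -/
theorem star_mem (I : CStarIdeal A) {a : A} (ha : a ∈ I.toSubmodule) :
    star a ∈ I.toSubmodule := by
  have hcl : IsClosed (I.toSubmodule : Set A) := I.isClosed'
  rw [← SetLike.mem_coe, ← hcl.closure_eq, Metric.mem_closure_iff]
  intro ε hε
  obtain ⟨k, hk⟩ := exists_approx a (δ := ε ^ 2) (by positivity)
  refine ⟨(star a * a) * (k * star a), I.mul_mem_right' _ (I.mul_mem_left' _ ha), ?_⟩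
  rw [dist_eq_norm]
  refine lt_of_pow_lt_pow_left₀ 2 hε.le (lt_of_le_of_lt hk ?_)
  have : 0 < ε ^ 2 := by positivity
  linarith

/-- The quotient `A / I`. As a complex vector space with the quotient norm
`‖a + I‖ = inf {‖a + b‖ : b ∈ I}` it is Mathlib's quotient of `A` by the subspace `I`; the product
and the involution are put on it below. -/
abbrev Quot (I : CStarIdeal A) : Type _ := A ⧸ I.toSubmodule

/-- The quotient map `π : A → A / I`. -/
def proj (I : CStarIdeal A) (a : A) : I.Quot := Submodule.Quotient.mk a

/-- The product of `A / I`, determined by `π(a) π(b) = π(a b)`. -/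
instance instMulQuot (I : CStarIdeal A) : Mul I.Quot where
  mul := Quotient.map₂ (· * ·) (by
    intro a a' ha b b' hb
    replace ha := (Submodule.quotientRel_def _).mp ha
    replace hb := (Submodule.quotientRel_def _).mp hb
    refine (Submodule.quotientRel_def _).mpr ?_
    have : a * b - a' * b' = (a - a') * b + a' * (b - b') := by
      rw [sub_mul, mul_sub]; abel
    change a * b - a' * b' ∈ _
    rw [this]
    exact I.toSubmodule.add_mem (I.mul_mem_right' _ ha) (I.mul_mem_left' _ hb))

/-- The involution of `A / I`, determined by `π(a)⋆ = π(a⋆)`. -/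
instance instStarQuot (I : CStarIdeal A) : Star I.Quot where
  star := Quotient.map star (by
    intro a a' ha
    replace ha := (Submodule.quotientRel_def _).mp ha
    refine (Submodule.quotientRel_def _).mpr ?_
    rw [← star_sub]
    exact I.star_mem ha)

theorem proj_surjective (I : CStarIdeal A) : Function.Surjective I.proj :=
  Submodule.Quotient.mk_surjective _

theorem proj_mul (I : CStarIdeal A) (a b : A) : I.proj (a * b) = I.proj a * I.proj b := rfl

theorem proj_star (I : CStarIdeal A) (a : A) : I.proj (star a) = star (I.proj a) := rfl

theorem proj_add (I : CStarIdeal A) (a b : A) : I.proj (a + b) = I.proj a + I.proj b := rfl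

theorem proj_smul (I : CStarIdeal A) (c : ℂ) (a : A) : I.proj (c • a) = c • I.proj a := rfl

theorem proj_zero (I : CStarIdeal A) : I.proj 0 = 0 := rfl

instance instNonUnitalRingQuot (I : CStarIdeal A) : NonUnitalRing I.Quot :=
  { (inferInstance : AddCommGroup I.Quot), instMulQuot I with
    left_distrib := by
      intro a b c
      obtain ⟨a, rfl⟩ := I.proj_surjective a
      obtain ⟨b, rfl⟩ := I.proj_surjective b
      obtain ⟨c, rfl⟩ := I.proj_surjective c
      simp only [← proj_mul, ← proj_add, mul_add]
    right_distrib := by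
      intro a b c
      obtain ⟨a, rfl⟩ := I.proj_surjective a
      obtain ⟨b, rfl⟩ := I.proj_surjective b
      obtain ⟨c, rfl⟩ := I.proj_surjective c
      simp only [← proj_mul, ← proj_add, add_mul]
    zero_mul := by
      intro a
      obtain ⟨a, rfl⟩ := I.proj_surjective a
      rw [← proj_zero, ← proj_mul, zero_mul]
    mul_zero := by
      intro a
      obtain ⟨a, rfl⟩ := I.proj_surjective a
      rw [← proj_zero, ← proj_mul, mul_zero]
    mul_assoc := by
      intro a b c
      obtain ⟨a, rfl⟩ := I.proj_surjective a
      obtain ⟨b, rfl⟩ := I.proj_surjective b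
      obtain ⟨c, rfl⟩ := I.proj_surjective c
      simp only [← proj_mul, mul_assoc] }

instance instIsScalarTowerQuot (I : CStarIdeal A) : IsScalarTower ℂ I.Quot I.Quot where
  smul_assoc := by
    intro c a b
    obtain ⟨a, rfl⟩ := I.proj_surjective a
    obtain ⟨b, rfl⟩ := I.proj_surjective b
    simp only [smul_eq_mul, ← proj_smul, ← proj_mul, smul_mul_assoc]

instance instSMulCommClassQuot (I : CStarIdeal A) : SMulCommClass ℂ I.Quot I.Quot where
  smul_comm := by
    intro c a b
    obtain ⟨a, rfl⟩ := I.proj_surjective a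
    obtain ⟨b, rfl⟩ := I.proj_surjective b
    simp only [smul_eq_mul, ← proj_smul, ← proj_mul, mul_smul_comm]

end CStarIdeal

/-! ### Noncommutative `*`-polynomials -/

/-- The letters from which the monomials of a `*`-polynomial in the variables `X_v`, `v : σ`,
are formed: the variables `X_v` and their formal adjoints `X_v⋆`. -/
inductive StarLetter (σ : Type*) where
  | var (v : σ) : StarLetter σ
  | adj (v : σ) : StarLetter σ

/-- The variable that a letter is made from: `v` for both `X_v` and `X_v⋆`. -/
def StarLetter.index {σ : Type*} : StarLetter σ → σ
  | .var v => v
  | .adj v => v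

/-- Noncommutative `*`-polynomials with complex coefficients in the variables `X_v`, `v : σ`:
finite linear combinations of nonempty words in the letters `X_v`, `X_v⋆`. There is no constant
term, so that such a polynomial can be evaluated in every C*-algebra, unital or not. -/
abbrev NCStarPoly (σ : Type*) : Type _ := MonoidAlgebra ℂ (FreeSemigroup (StarLetter σ))

namespace NCStarPoly

variable {σ : Type*}

/-- The homomorphism of complex algebras on `*`-polynomials that substitutes the element `f ℓ` for
each letter `ℓ`. -/
noncomputable def subst {B : Type*} [NonUnitalRing B] [Module ℂ B] [IsScalarTower ℂ B B]
    [SMulCommClass ℂ B B] (f : StarLetter σ → B) : NCStarPoly σ →ₙₐ[ℂ] B :=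
  MonoidAlgebra.liftMagma ℂ (FreeSemigroup.lift f)

/-- The value `p(v)` of a `*`-polynomial at a family `v` of elements of a complex `*`-algebra:
`X_k` is replaced by `v k` and `X_k⋆` by the adjoint of `v k`. -/
noncomputable def eval {B : Type*} [NonUnitalRing B] [Star B] [Module ℂ B] [IsScalarTower ℂ B B]
    [SMulCommClass ℂ B B] (p : NCStarPoly σ) (v : σ → B) : B :=
  subst (fun
    | .var k => v k
    | .adj k => star (v k)) p

/-- The letter `ℓ` regarded as a `*`-polynomial. -/
noncomputable def ofLetter (ℓ : StarLetter σ) : NCStarPoly σ :=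
  MonoidAlgebra.single (FreeSemigroup.of ℓ) 1

/-- The `*`-polynomial `p(t x, y)` for a real scalar `t`, where the variables are
`x = (X_(inl 0), …, X_(inl (r-1)))` and `y = (X_(inr 0), X_(inr 1), …)`: every letter
`X_k` or `X_k⋆` with `k` among the first `r` variables is multiplied by `t`
(note `(t X_k)⋆ = t X_k⋆`, as `t` is real). -/
noncomputable def scaleFirst {r : ℕ} (t : ℝ) (p : NCStarPoly (Fin r ⊕ ℕ)) :
    NCStarPoly (Fin r ⊕ ℕ) :=
  subst (fun ℓ => match ℓ.index with
    | Sum.inl _ => (t : ℂ) • ofLetter ℓ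
    | Sum.inr _ => ofLetter ℓ) p

/-- `p` is `d`-homogeneous in the first `r` variables: `p(t x, y) = t ^ d p(x, y)` for all real
scalars `t`. -/
def IsHomogeneousInFirst {r : ℕ} (p : NCStarPoly (Fin r ⊕ ℕ)) (d : ℕ) : Prop :=
  ∀ t : ℝ, scaleFirst t p = ((t : ℂ) ^ d) • p

end NCStarPoly

/-! Suppose `z` satisfies the bounds up to an excess `ε`, and write `a = p_j(z, y)`. Let `e` be a
quasicentral approximate unit of `I`, and replace each `z_k` by `z_k^{1/2} (1 - δ e) z_k^{1/2}`.
This lies between `0` and `z_k` and has the same image in `A / I`. Since `e` asymptotically commutes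
with everything in sight, homogeneity gives `p_j(z', y) ≈ (1 - δ e)^d a`
(`tendsto_subst_sub_pow_mul`), and as `d ≥ 1` its norm is at most about `‖(1 - δ e) a‖`.

Choose `i ∈ I` with `‖a - i‖` close to the quotient norm of `a`. As `(1 - e) i ≈ 0`, `(1 - δ e) a =
(1 - e) a + e (1 - δ) a ≈ (1 - e) (a - i) + e (1 - δ) a`, an operator convex combination of two
elements of norm at most about `C_j`, once `δ` is so large that `(1 - δ) ‖a‖ ≤ C_j`. With
asymptotically central weights such a combination obeys the same bound
(`eventually_norm_convex_le`).

This makes the excess as small as desired (`exists_compression`) while moving `z_k` by at most `δ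
‖z_k‖`, where `δ` is of order `ε`. Iterating with excesses that halve yields a Cauchy sequence,
whose limit satisfies the exact bounds. -/

open Filter Topology

/-! ### Quasicentral approximate units of closed ideals. -/

namespace CStarIdeal

variable {A : Type*} [NonUnitalCStarAlgebra A]

/-- A closed two-sided ideal as a non-unital star subalgebra. -/
def toStarSubalgebra (I : CStarIdeal A) : NonUnitalStarSubalgebra ℂ A where
  carrier := I.carrier
  add_mem' := I.add_mem'
  zero_mem' := I.zero_mem'
  smul_mem' := I.smul_mem'
  mul_mem' := fun {a _} _ hb => I.mul_mem_left' a hb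
  star_mem' := fun ha => I.star_mem ha

variable [PartialOrder A] [StarOrderedRing A]

/-- Finitely many elements of a closed ideal have a common approximate unit in the ideal. -/
theorem exists_approximateUnit (I : CStarIdeal A) {G : Set A} (hG : G.Finite)
    (hGI : ∀ g ∈ G, g ∈ I.toSubmodule) {ε : ℝ} (hε : 0 < ε) :
    ∃ e ∈ I.toSubmodule, 0 ≤ e ∧ ‖e‖ ≤ 1 ∧ ∀ g ∈ G, ‖g * e - g‖ ≤ ε := by
  let S := I.toStarSubalgebra
  have hS : IsClosed (S : Set A) := I.isClosed'
  let _ : NonUnitalCStarAlgebra S := NonUnitalStarSubalgebra.nonUnitalCStarAlgebra S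
  let _ : PartialOrder S := CStarAlgebra.spectralOrder S
  have : StarOrderedRing S := CStarAlgebra.spectralOrderedRing S
  have hl := CStarAlgebra.increasingApproximateUnit S
  have h1 : ∀ᶠ e in CStarAlgebra.approximateUnit S,
      ∀ g ∈ ((↑) : S → A) ⁻¹' G, ‖g * e - g‖ ≤ ε := by
    rw [eventually_all_finite (hG.preimage Subtype.val_injective.injOn)]
    intro g _
    have := (tendsto_iff_norm_sub_tendsto_zero.1 (hl.tendsto_mul_left g)).eventually
      (ge_mem_nhds hε)
    exact this
  obtain ⟨e, he, he0, he1⟩ :=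
    (h1.and (hl.eventually_nonneg.and hl.eventually_norm)).exists
  refine ⟨e, e.2, ?_, he1, fun g hg => he ⟨g, hGI g hg⟩ hg⟩
  -- The order on `S` is its own spectral order; positivity passes to `A` through the factorization
  -- `star s * s`.
  obtain ⟨s, rfl⟩ := CStarAlgebra.nonneg_iff_eq_star_mul_self.1 he0
  exact star_mul_self_nonneg (s : A)

/-- If `f` were an exact right unit for `e`, `e c`, `e c⋆` and `e c⋆ c`, the four terms of the
expanded product would cancel. Commutators of `c` with successive approximate units are thus almost
orthogonal. -/
theorem norm_star_commutator_mul_commutator_le {A : Type*} [NonUnitalCStarAlgebra A]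
    {e f c : A} {η : ℝ} (he : IsSelfAdjoint e)
    (h1 : ‖e * f - e‖ ≤ η) (h2 : ‖e * c * f - e * c‖ ≤ η)
    (h3 : ‖e * star c * f - e * star c‖ ≤ η)
    (h4 : ‖e * (star c * c) * f - e * (star c * c)‖ ≤ η) :
    ‖star (e * c - c * e) * (f * c - c * f)‖ ≤ η * (‖c‖ + 1) ^ 2 := by
  have key : star (e * c - c * e) * (f * c - c * f) =
      star c * (e * f - e) * c - star c * (e * c * f - e * c)
        - (e * star c * f - e * star c) * c + (e * (star c * c) * f - e * (star c * c)) := by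
    simp only [star_sub, star_mul, he.star_eq, sub_mul, mul_sub, mul_assoc]
    abel
  have hc := norm_nonneg c
  have b1 : ‖star c * (e * f - e) * c‖ ≤ ‖c‖ * η * ‖c‖ := by
    refine (norm_mul_le _ _).trans ?_
    gcongr
    refine (norm_mul_le _ _).trans ?_
    rw [norm_star]
    gcongr
  have b2 : ‖star c * (e * c * f - e * c)‖ ≤ ‖c‖ * η := by
    refine (norm_mul_le _ _).trans ?_
    rw [norm_star]
    gcongr
  have b3 : ‖(e * star c * f - e * star c) * c‖ ≤ η * ‖c‖ := by
    refine (norm_mul_le _ _).trans ?_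
    gcongr
  rw [key]
  refine (norm_add_le_of_le (norm_sub_le_of_le (norm_sub_le_of_le b1 b2) b3) h4).trans ?_
  linarith

/-- Almost orthogonality makes the norm of the sum grow like `√n` up to the error `η`, so averages
of commutators become small. This replaces the usual Hahn-Banach convexity argument for
quasicentrality. -/
theorem norm_sum_sq_le {A : Type*} [NonUnitalCStarAlgebra A] (d : ℕ → A) {K η : ℝ} (n : ℕ)
    (hK : ∀ k, ‖d k‖ ≤ K) (hd : ∀ k l, k < l → ‖star (d k) * d l‖ ≤ η) :
    ‖∑ k ∈ Finset.range n, d k‖ ^ 2 ≤ n * K ^ 2 + n ^ 2 * η := by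
  by_cases hη : 0 ≤ η
  · have hkl : ∀ k l, ‖star (d k) * d l‖ ≤ (if k = l then K ^ 2 else 0) + η := by
      intro k l
      rcases lt_trichotomy k l with h | rfl | h
      · simpa [h.ne] using hd k l h
      · rw [if_pos rfl, CStarRing.norm_star_mul_self, ← sq]
        have := pow_le_pow_left₀ (norm_nonneg _) (hK k) 2
        linarith
      · rw [← norm_star, star_mul, star_star]
        simpa [h.ne'] using hd l k h
    rw [sq, ← CStarRing.norm_star_mul_self, star_sum, Finset.sum_mul_sum]
    refine (norm_sum_le_of_le _ fun k _ => norm_sum_le_of_le _ fun l _ => hkl k l).trans ?_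
    have : ∀ k ∈ Finset.range n,
        ∑ l ∈ Finset.range n, ((if k = l then K ^ 2 else 0) + η) = K ^ 2 + n * η := by
      intro k hk
      rw [Finset.sum_add_distrib, Finset.sum_ite_eq, if_pos hk]
      simp
    rw [Finset.sum_congr rfl this]
    simp only [Finset.sum_const, Finset.card_range, nsmul_eq_mul]
    apply le_of_eq
    ring
  · exact absurd ((norm_nonneg _).trans (hd 0 1 one_pos)) hη

/-- Approximate units of a closed ideal may be chosen quasicentral. -/
theorem exists_quasicentral (I : CStarIdeal A) {F G : Set A} (hF : F.Finite) (hG : G.Finite)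
    (hGI : ∀ g ∈ G, g ∈ I.toSubmodule) {ε : ℝ} (hε : 0 < ε) :
    ∃ e ∈ I.toSubmodule, 0 ≤ e ∧ ‖e‖ ≤ 1 ∧ (∀ c ∈ F, ‖e * c - c * e‖ ≤ ε) ∧
      ∀ g ∈ G, ‖g * e - g‖ ≤ ε := by
  obtain ⟨M, hM0, hM⟩ : ∃ M : ℝ, 0 < M ∧ ∀ c ∈ F, ‖c‖ ≤ M := by
    obtain ⟨M, hM⟩ := hF.isBounded.exists_norm_le
    exact ⟨max M 1, by positivity, fun c hc => (hM c hc).trans (le_max_left _ _)⟩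
  obtain ⟨η, hη0, hη⟩ : ∃ η : ℝ, 0 < η ∧ η * (M + 1) ^ 2 ≤ ε ^ 2 / 2 :=
    ⟨ε ^ 2 / 2 / (M + 1) ^ 2, by positivity, by rw [div_mul_cancel₀ _ (by positivity)]⟩
  let P : A → Prop := fun e => e ∈ I.toSubmodule ∧ 0 ≤ e ∧ ‖e‖ ≤ 1 ∧ ∀ g ∈ G, ‖g * e - g‖ ≤ ε
  -- `f` is almost a right unit for `e` and for the products of `e` that enter the commutator
  -- estimate.
  let R : A → A → Prop := fun e f => ‖e * f - e‖ ≤ η ∧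
    ∀ b ∈ F ∪ star '' F ∪ (fun c => star c * c) '' F, ‖e * b * f - e * b‖ ≤ η
  obtain ⟨f, hfP, hfR⟩ := exists_seq_of_forall_finset_exists P R (by
    intro s hs
    let B : Set A := F ∪ star '' F ∪ (fun c => star c * c) '' F
    have hB : B.Finite := (hF.union (hF.image _)).union (hF.image _)
    obtain ⟨e, heI, he0, he1, he⟩ := I.exists_approximateUnit
      (G := G ∪ (s ∪ Set.image2 (· * ·) s B))
      (hG.union (s.finite_toSet.union (s.finite_toSet.image2 _ hB))) (by
        rintro g (hg | hg | ⟨a, ha, b, -, rfl⟩)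
        · exact hGI g hg
        · exact (hs g hg).1
        · exact I.mul_mem_right' b (hs a ha).1) (lt_min hε hη0)
    refine ⟨e, ⟨heI, he0, he1, fun g hg => (he g (.inl hg)).trans (min_le_left _ _)⟩, ?_⟩
    intro a ha
    exact ⟨(he a (.inr (.inl ha))).trans (min_le_right _ _), fun b hb =>
      (he _ (.inr (.inr ⟨a, ha, b, hb, rfl⟩))).trans (min_le_right _ _)⟩)
  -- The commutators have norm at most `2 M`, so this `n` makes `n (2 M)² + n² ε² / 2 ≤ (n ε)²`.
  obtain ⟨n, hn⟩ := exists_nat_gt (8 * M ^ 2 / ε ^ 2)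
  have hn0 : (0 : ℝ) < n := lt_of_le_of_lt (by positivity) hn
  have hav : ∀ v : A, (n : ℝ)⁻¹ • ∑ _k ∈ Finset.range n, v = v := by
    intro v
    rw [Finset.sum_const, Finset.card_range, ← Nat.cast_smul_eq_nsmul ℝ, smul_smul,
      inv_mul_cancel₀ hn0.ne', one_smul]
  have hbd : ∀ (v : ℕ → A) (K : ℝ), (∀ k, ‖v k‖ ≤ K) →
      ‖(n : ℝ)⁻¹ • ∑ k ∈ Finset.range n, v k‖ ≤ K := by
    intro v K hv
    rw [norm_smul, norm_inv, Real.norm_natCast, inv_mul_le_iff₀ hn0]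
    refine (norm_sum_le_of_le _ fun k _ => hv k).trans ?_
    simp
  refine ⟨(n : ℝ)⁻¹ • ∑ k ∈ Finset.range n, f k, ?_, ?_, hbd _ _ fun k => (hfP k).2.2.1, ?_, ?_⟩
  · rw [← Complex.coe_smul]
    exact I.toSubmodule.smul_mem _ (I.toSubmodule.sum_mem fun k _ => (hfP k).1)
  · exact smul_nonneg (by positivity) (Finset.sum_nonneg fun k _ => (hfP k).2.1)
  · intro c hc
    have hcM := hM c hc
    have h := norm_sum_sq_le (fun k => f k * c - c * f k) (K := 2 * M) (η := ε ^ 2 / 2) n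
      (fun k => by
        have h1 := norm_mul_le (f k) c
        have h2 := norm_mul_le c (f k)
        have h3 := (hfP k).2.2.1
        have := norm_sub_le (f k * c) (c * f k)
        nlinarith [norm_nonneg c])
      (fun k l hkl => by
        obtain ⟨r1, r2⟩ := hfR k l hkl
        refine (norm_star_commutator_mul_commutator_le (.of_nonneg (hfP k).2.1) r1
          (r2 c (.inl (.inl hc))) (r2 _ (.inl (.inr ⟨c, hc, rfl⟩)))
          (r2 _ (.inr ⟨c, hc, rfl⟩))).trans (le_trans ?_ hη)
        gcongr)
    rw [smul_mul_assoc, mul_smul_comm, ← smul_sub, Finset.sum_mul, Finset.mul_sum,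
      ← Finset.sum_sub_distrib, norm_smul, norm_inv, Real.norm_natCast, inv_mul_le_iff₀ hn0]
    refine le_of_sq_le_sq (h.trans ?_) (by positivity)
    rw [div_lt_iff₀ (by positivity)] at hn
    nlinarith
  · intro g hg
    have : g * ((n : ℝ)⁻¹ • ∑ k ∈ Finset.range n, f k) - g =
        (n : ℝ)⁻¹ • ∑ k ∈ Finset.range n, (g * f k - g) := by
      rw [Finset.sum_sub_distrib, smul_sub, hav, mul_smul_comm, Finset.mul_sum]
    rw [this]
    exact hbd _ _ fun k => (hfP k).2.2.2 g hg

end CStarIdeal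

namespace CStarIdeal

variable {A : Type*} [NonUnitalCStarAlgebra A] [PartialOrder A] [StarOrderedRing A]

/-- A quasicentral sequence in a closed ideal, for countably many elements. -/
theorem exists_quasicentral_seq (I : CStarIdeal A) {ι κ : Type*} [Countable ι] [Countable κ]
    (F : ι → A) (G : κ → A) (hG : ∀ k, G k ∈ I.toSubmodule) :
    ∃ e : ℕ → A, (∀ n, e n ∈ I.toSubmodule) ∧ (∀ n, 0 ≤ e n) ∧ (∀ n, ‖e n‖ ≤ 1) ∧
      (∀ i, Tendsto (fun n => e n * F i - F i * e n) atTop (𝓝 0)) ∧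
      ∀ k, Tendsto (fun n => e n * G k - G k) atTop (𝓝 0) := by
  obtain ⟨f, hf⟩ := exists_injective_nat ι
  obtain ⟨g, hg⟩ := exists_injective_nat κ
  -- Adjoints of the `G k` are used because `exists_quasicentral` gives a right approximate unit and
  -- a left one is wanted.
  have h := fun n : ℕ => I.exists_quasicentral (F := F '' (f ⁻¹' Set.Iic n))
    (G := (star ∘ G) '' (g ⁻¹' Set.Iic n))
    (((Set.finite_Iic n).preimage hf.injOn).image _)
    (((Set.finite_Iic n).preimage hg.injOn).image _)
    (by rintro _ ⟨k, -, rfl⟩; exact I.star_mem (hG k)) (ε := 1 / ((n : ℝ) + 1)) (by positivity)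
  choose e heI he0 he1 heF heG using h
  refine ⟨e, heI, he0, he1, fun i => ?_, fun k => ?_⟩
  · refine squeeze_zero_norm' ?_ tendsto_one_div_add_atTop_nhds_zero_nat
    filter_upwards [eventually_ge_atTop (f i)] with n hn
    exact heF n _ ⟨i, hn, rfl⟩
  · refine squeeze_zero_norm' ?_ tendsto_one_div_add_atTop_nhds_zero_nat
    filter_upwards [eventually_ge_atTop (g k)] with n hn
    have := heG n _ ⟨k, hn, rfl⟩
    rw [← norm_star]
    simpa [(IsSelfAdjoint.of_nonneg (he0 n)).star_eq] using this

end CStarIdeal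

/-! ### Operator convex combinations with asymptotically central weights. -/

section Unital

variable {U : Type*} [CStarAlgebra U] [PartialOrder U] [StarOrderedRing U]

/-- The defect operator `(M² - c⋆c)^{1/2}`. -/
noncomputable def defect (M : ℝ) (c : U) : U := CFC.sqrt (algebraMap ℝ U (M ^ 2) - star c * c)

theorem defect_nonneg (M : ℝ) (c : U) : 0 ≤ defect M c := CFC.sqrt_nonneg _

theorem star_mul_self_add_defect_mul_defect {M : ℝ} {c : U} (hc : ‖c‖ ≤ M) :
    star c * c + defect M c * defect M c = algebraMap ℝ U (M ^ 2) := by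
  rw [defect, CFC.sqrt_mul_sqrt_self _ (sub_nonneg.2 ?_), add_sub_cancel]
  refine CStarAlgebra.star_mul_le_algebraMap_norm_sq.trans ?_
  exact algebraMap_mono U (pow_le_pow_left₀ (norm_nonneg c) hc 2)

/-- The difference of the two sides is `(c - b)⋆ (e - e²) (c - b)`. -/
theorem star_mul_self_convex_le {e : U} (he0 : 0 ≤ e) (he1 : e ≤ 1) (c b : U) :
    star ((1 - e) * c + e * b) * ((1 - e) * c + e * b) ≤
      star c * (1 - e) * c + star b * e * b := by
  have h : 0 ≤ e - e * e := by
    have := CStarAlgebra.pow_antitone he0 he1 (show 1 ≤ 2 by norm_num)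
    simpa [sq] using this
  rw [← sub_nonneg]
  convert star_left_conjugate_nonneg h (c - b) using 1
  simp only [star_add, star_mul, star_sub, star_one, (IsSelfAdjoint.of_nonneg he0).star_eq]
  noncomm_ring

/-- The defects complete `c⋆ c` and `b⋆ b` to the scalar `M²`. Once `e n` is moved past the outer
factors, the weights `1 - e n` and `e n` add up to `1`, so the upper bound `D n` for the square
tends to `M²`. -/
theorem eventually_norm_convex_le {e : ℕ → U} (he0 : ∀ n, 0 ≤ e n) (he1 : ∀ n, ‖e n‖ ≤ 1)
    {M η : ℝ} (hM : 0 < M) (hη : 0 < η) {c b : U} (hc : ‖c‖ ≤ M) (hb : ‖b‖ ≤ M)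
    (h1 : Tendsto (fun n => e n * star c - star c * e n) atTop (𝓝 0))
    (h2 : Tendsto (fun n => e n * star b - star b * e n) atTop (𝓝 0))
    (h3 : Tendsto (fun n => e n * defect M c - defect M c * e n) atTop (𝓝 0))
    (h4 : Tendsto (fun n => e n * defect M b - defect M b * e n) atTop (𝓝 0)) :
    ∀ᶠ n in atTop, ‖(1 - e n) * c + e n * b‖ ≤ M + η := by
  let g := defect M c
  let h := defect M b
  let D : ℕ → U := fun n => star c * (1 - e n) * c + star b * e n * b
    + (g * (1 - e n) * g + h * e n * h)
  have hD : ∀ n, D n = algebraMap ℝ U (M ^ 2) + ((e n * star c - star c * e n) * c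
      + (e n * g - g * e n) * g - (e n * star b - star b * e n) * b
      - (e n * h - h * e n) * h) := by
    intro n
    have hcg : g * g = algebraMap ℝ U (M ^ 2) - star c * c :=
      eq_sub_of_add_eq' (star_mul_self_add_defect_mul_defect hc)
    have hbh : h * h = algebraMap ℝ U (M ^ 2) - star b * b :=
      eq_sub_of_add_eq' (star_mul_self_add_defect_mul_defect hb)
    simp only [D, mul_sub, sub_mul, mul_one, mul_assoc, hcg, hbh]
    abel
  have hlim : Tendsto D atTop (𝓝 (algebraMap ℝ U (M ^ 2))) := by
    simp only [funext hD]
    have := (((h1.mul_const c).add (h3.mul_const g)).sub (h2.mul_const b)).sub (h4.mul_const h)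
    rw [zero_mul, zero_mul, zero_mul, zero_mul, add_zero, sub_zero, sub_zero] at this
    simpa only [add_zero] using this.const_add (algebraMap ℝ U (M ^ 2))
  have hlt : ‖algebraMap ℝ U (M ^ 2)‖ < (M + η) ^ 2 := by
    refine lt_of_le_of_lt (b := M ^ 2) ?_ (by nlinarith)
    rcases subsingleton_or_nontrivial U with hU | hU
    · rw [Subsingleton.elim (algebraMap ℝ U (M ^ 2)) 0, norm_zero]
      positivity
    · rw [norm_algebraMap', Real.norm_of_nonneg (by positivity)]
  filter_upwards [hlim.norm.eventually_lt_const hlt] with n hn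
  have hn1 : e n ≤ 1 := (CStarAlgebra.norm_le_one_iff_of_nonneg _ (he0 n)).1 (he1 n)
  refine le_of_sq_le_sq (le_trans ?_ hn.le) (by positivity)
  rw [sq, ← CStarRing.norm_star_mul_self]
  refine CStarAlgebra.norm_le_norm_of_nonneg_of_le (star_mul_self_nonneg _) ?_
  refine (star_mul_self_convex_le (he0 n) hn1 c b).trans (le_add_of_nonneg_right ?_)
  exact add_nonneg
    (conjugate_nonneg_of_nonneg (sub_nonneg.2 hn1) (defect_nonneg M c))
    (conjugate_nonneg_of_nonneg (he0 n) (defect_nonneg M b))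

end Unital

/-! ### Words, homogeneity and asymptotic evaluation of `*`-polynomials. -/

namespace NCStarPoly

variable {σ : Type*}

section Algebraic

variable {B : Type*} [NonUnitalRing B] [Module ℂ B] [IsScalarTower ℂ B B] [SMulCommClass ℂ B B]

theorem subst_eq_sum (f : StarLetter σ → B) (p : NCStarPoly σ) :
    subst f p = ∑ w ∈ p.coeff.support, p.coeff w • FreeSemigroup.lift f w := by
  simp [subst, MonoidAlgebra.liftMagma_apply_apply, Finsupp.sum]

theorem map_lift {B' : Type*} [Semigroup B'] {B : Type*} [Semigroup B] (φ : B →ₙ* B')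
    (f : StarLetter σ → B) (w : FreeSemigroup (StarLetter σ)) :
    φ (FreeSemigroup.lift f w) = FreeSemigroup.lift (fun ℓ => φ (f ℓ)) w :=
  DFunLike.congr_fun (FreeSemigroup.hom_ext (f := φ.comp (FreeSemigroup.lift f))
    (g := FreeSemigroup.lift (fun ℓ => φ (f ℓ))) rfl) w

theorem map_subst {B' : Type*} [NonUnitalRing B'] [Module ℂ B'] [IsScalarTower ℂ B' B']
    [SMulCommClass ℂ B' B'] (φ : B →ₙₐ[ℂ] B') (f : StarLetter σ → B) (p : NCStarPoly σ) :
    φ (subst f p) = subst (fun ℓ => φ (f ℓ)) p := by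
  rw [subst_eq_sum, subst_eq_sum, map_sum]
  refine Finset.sum_congr rfl fun w _ => ?_
  rw [map_smul]
  congr 1
  exact map_lift φ.toMulHom f w

/-- The values that `NCStarPoly.eval` substitutes for the letters. -/
def letterValue {B : Type*} [Star B] (v : σ → B) : StarLetter σ → B
  | .var k => v k
  | .adj k => star (v k)

theorem eval_eq_subst [Star B] (p : NCStarPoly σ) (v : σ → B) :
    p.eval v = subst (letterValue v) p := rfl

theorem map_eval {B' : Type*} [NonUnitalRing B'] [Module ℂ B'] [IsScalarTower ℂ B' B']
    [SMulCommClass ℂ B' B'] [Star B] [Star B'] (φ : B →ₙₐ[ℂ] B')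
    (hφ : ∀ b, φ (star b) = star (φ b)) (p : NCStarPoly σ) (v : σ → B) :
    φ (p.eval v) = p.eval (fun k => φ (v k)) := by
  rw [eval_eq_subst, eval_eq_subst, map_subst]
  congr 2
  funext ℓ
  cases ℓ with
  | var k => rfl
  | adj k => exact hφ _

end Algebraic

/-- The weight of a word for given weights of the letters. -/
def wordWeight (wt : StarLetter σ → ℕ) (w : FreeSemigroup (StarLetter σ)) : ℕ :=
  (FreeSemigroup.lift (fun ℓ => Multiplicative.ofAdd (wt ℓ)) w).toAdd

@[simp]
theorem wordWeight_of (wt : StarLetter σ → ℕ) (ℓ : StarLetter σ) :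
    wordWeight wt (FreeSemigroup.of ℓ) = wt ℓ := rfl

@[simp]
theorem wordWeight_mul (wt : StarLetter σ → ℕ) (w w' : FreeSemigroup (StarLetter σ)) :
    wordWeight wt (w * w') = wordWeight wt w + wordWeight wt w' := by
  simp [wordWeight]

/-- Letters from the first `r` variables have weight one, the other letters weight zero. -/
def firstWeight {r : ℕ} (ℓ : StarLetter (Fin r ⊕ ℕ)) : ℕ :=
  match ℓ.index with
  | .inl _ => 1
  | .inr _ => 0

theorem scaleFirst_eq_subst {r : ℕ} (t : ℝ) (p : NCStarPoly (Fin r ⊕ ℕ)) :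
    scaleFirst t p = subst (fun ℓ => (t : ℂ) ^ firstWeight ℓ • ofLetter ℓ) p := by
  rw [scaleFirst]
  congr 2
  funext ℓ
  cases h : ℓ.index <;> simp [firstWeight, h]

theorem lift_smul_ofLetter (t : ℂ) (wt : StarLetter σ → ℕ) (w : FreeSemigroup (StarLetter σ)) :
    FreeSemigroup.lift (fun ℓ => t ^ wt ℓ • ofLetter ℓ) w =
      (MonoidAlgebra.single w (t ^ wordWeight wt w) : NCStarPoly σ) := by
  induction w using FreeSemigroup.recOnMul with
  | ih1 ℓ => simp [ofLetter]
  | ih2 ℓ w h1 h2 =>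
    rw [map_mul, h1, h2, MonoidAlgebra.single_mul_single, wordWeight_mul, pow_add]

/-- All words of a polynomial that is homogeneous in the first variables have the same number of
letters from these variables. -/
theorem IsHomogeneousInFirst.wordWeight_eq {r : ℕ} {p : NCStarPoly (Fin r ⊕ ℕ)} {d : ℕ}
    (hp : p.IsHomogeneousInFirst d) {w : FreeSemigroup (StarLetter (Fin r ⊕ ℕ))}
    (hw : w ∈ p.coeff.support) : wordWeight firstWeight w = d := by
  classical
  -- The single scalar `t = 2` suffices: comparing coefficients at `w` gives `2 ^ weight = 2 ^ d`.
  have h := congrArg (fun q => q.coeff w) (hp 2)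
  simp only [scaleFirst_eq_subst, subst_eq_sum, lift_smul_ofLetter, MonoidAlgebra.coeff_sum,
    MonoidAlgebra.coeff_smul, MonoidAlgebra.coeff_single, Finsupp.coe_finsetSum,
    Finset.sum_apply, Finsupp.smul_apply, Finsupp.single_apply, smul_eq_mul, mul_ite, mul_zero,
    Finset.sum_ite_eq', if_pos hw] at h
  rw [mul_comm] at h
  have h2 := mul_right_cancel₀ (Finsupp.mem_support_iff.1 hw) h
  exact Nat.pow_right_injective (le_refl 2) (by exact_mod_cast h2)

section Asymptotic

variable {U : Type*} [NormedRing U] {q : ℕ → U}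

theorem tendsto_pow_commutator {K : ℝ} (hq : ∀ n k, ‖q n ^ k‖ ≤ K) {v : U}
    (hv : Tendsto (fun n => q n * v - v * q n) atTop (𝓝 0)) (b : ℕ) :
    Tendsto (fun n => q n ^ b * v - v * q n ^ b) atTop (𝓝 0) := by
  have hbd : ∀ k, IsBoundedUnder (· ≤ ·) atTop (norm ∘ fun n => q n ^ k) := fun k =>
    isBoundedUnder_of ⟨K, fun n => hq n k⟩
  induction b with
  | zero => simp
  | succ b ih =>
    have h1 : ∀ n, q n ^ (b + 1) * v - v * q n ^ (b + 1) =
        q n ^ b * (q n * v - v * q n) + (q n ^ b * v - v * q n ^ b) * q n ^ 1 := by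
      intro n
      rw [pow_succ, pow_one]
      noncomm_ring
    rw [funext h1]
    simpa using (isBoundedUnder_le_mul_tendsto_zero (hbd b) hv).add
      (ih.zero_mul_isBoundedUnder_le (hbd 1))

/-- Induction on the word: each letter contributes its power of `q n`, which is then moved to the
left at the cost of commutators tending to zero. The bound on all powers of `q n` keeps the errors
under control. -/
theorem tendsto_lift_sub_pow_mul {K : ℝ} (hq : ∀ n k, ‖q n ^ k‖ ≤ K) (wt : StarLetter σ → ℕ)
    {f : ℕ → StarLetter σ → U} {g : StarLetter σ → U}
    (hg : ∀ ℓ, Tendsto (fun n => q n * g ℓ - g ℓ * q n) atTop (𝓝 0))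
    (hf : ∀ ℓ, Tendsto (fun n => f n ℓ - q n ^ wt ℓ * g ℓ) atTop (𝓝 0))
    (w : FreeSemigroup (StarLetter σ)) :
    Tendsto (fun n => FreeSemigroup.lift (f n) w - q n ^ wordWeight wt w * FreeSemigroup.lift g w)
      atTop (𝓝 0) := by
  have hbd : ∀ (k : ℕ) (v : U), IsBoundedUnder (· ≤ ·) atTop (norm ∘ fun n => q n ^ k * v) :=
    fun k v => isBoundedUnder_of ⟨K * ‖v‖, fun n =>
      (norm_mul_le _ _).trans (by gcongr; exact hq n k)⟩
  induction w using FreeSemigroup.recOnMul with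
  | ih1 ℓ => exact hf ℓ
  | ih2 ℓ w h1 h2 =>
    clear h1
    set W := FreeSemigroup.lift g w
    set b := wordWeight wt w
    have key : ∀ n, FreeSemigroup.lift (f n) (FreeSemigroup.of ℓ * w)
        - q n ^ wordWeight wt (FreeSemigroup.of ℓ * w)
          * FreeSemigroup.lift g (FreeSemigroup.of ℓ * w) =
        (f n ℓ - q n ^ wt ℓ * g ℓ) * (FreeSemigroup.lift (f n) w - q n ^ b * W)
        + (f n ℓ - q n ^ wt ℓ * g ℓ) * (q n ^ b * W)
        + (q n ^ wt ℓ * g ℓ) * (FreeSemigroup.lift (f n) w - q n ^ b * W)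
        - (q n ^ wt ℓ * 1) * ((q n ^ b * g ℓ - g ℓ * q n ^ b) * W) := by
      intro n
      rw [map_mul, map_mul, wordWeight_mul, wordWeight_of, FreeSemigroup.lift_of,
        FreeSemigroup.lift_of, pow_add]
      noncomm_ring
    rw [funext key]
    have t1 := (hf ℓ).mul h2
    have t2 := (hf ℓ).zero_mul_isBoundedUnder_le (hbd b W)
    have t3 := isBoundedUnder_le_mul_tendsto_zero (hbd (wt ℓ) (g ℓ)) h2
    have t4 := isBoundedUnder_le_mul_tendsto_zero (hbd (wt ℓ) 1)
      (by simpa using (tendsto_pow_commutator hq (hg ℓ) b).mul_const W)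
    simpa using ((t1.add t2).add t3).sub t4

/-- Substituting letters `f n ℓ` that are asymptotically `g ℓ` or `q n * g ℓ` into a homogeneous
polynomial of degree `d` amounts asymptotically to multiplication by `q n ^ d`. -/
theorem tendsto_subst_sub_pow_mul [NormedAlgebra ℂ U] {K : ℝ} (hq : ∀ n k, ‖q n ^ k‖ ≤ K)
    (wt : StarLetter σ → ℕ) {f : ℕ → StarLetter σ → U} {g : StarLetter σ → U}
    (hg : ∀ ℓ, Tendsto (fun n => q n * g ℓ - g ℓ * q n) atTop (𝓝 0))
    (hf : ∀ ℓ, Tendsto (fun n => f n ℓ - q n ^ wt ℓ * g ℓ) atTop (𝓝 0))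
    {p : NCStarPoly σ} {d : ℕ} (hp : ∀ w ∈ p.coeff.support, wordWeight wt w = d) :
    Tendsto (fun n => subst (f n) p - q n ^ d * subst g p) atTop (𝓝 0) := by
  have key : ∀ n, subst (f n) p - q n ^ d * subst g p = ∑ w ∈ p.coeff.support, p.coeff w •
      (FreeSemigroup.lift (f n) w - q n ^ wordWeight wt w * FreeSemigroup.lift g w) := by
    intro n
    rw [subst_eq_sum, subst_eq_sum, Finset.mul_sum, ← Finset.sum_sub_distrib]
    refine Finset.sum_congr rfl fun w hw => ?_
    rw [hp w hw, mul_smul_comm, smul_sub]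
  rw [funext key, ← Finset.sum_const_zero (s := p.coeff.support)]
  refine tendsto_finsetSum _ fun w _ => ?_
  simpa using (tendsto_lift_sub_pow_mul hq wt hg hf w).const_smul (p.coeff w)

end Asymptotic

theorem continuous_eval {B X : Type*} [NonUnitalCStarAlgebra B] [TopologicalSpace X]
    (p : NCStarPoly σ) {v : X → σ → B} (hv : ∀ k, Continuous fun x => v x k) :
    Continuous fun x => p.eval (v x) := by
  simp only [eval_eq_subst, subst_eq_sum]
  refine continuous_finsetSum _ fun w hw => Continuous.const_smul ?_ _
  clear hw
  induction w using FreeSemigroup.recOnMul with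
  | ih1 ℓ =>
    cases ℓ with
    | var k => exact hv k
    | adj k => exact (hv k).star
  | ih2 ℓ w h1 h2 =>
    simp only [map_mul]
    exact h1.mul h2

end NCStarPoly

instance {σ : Type*} [Countable σ] : Countable (StarLetter σ) := by
  refine Function.Injective.countable (β := σ ⊕ σ)
    (f := fun | .var v => .inl v | .adj v => .inr v) ?_
  rintro (v | v) (w | w) h <;> simp_all

/-! ### Quotient norms and one compression step. -/

namespace CStarIdeal

variable {A : Type*} [NonUnitalCStarAlgebra A]

/-- The quotient map as an algebra homomorphism. -/
def projHom (I : CStarIdeal A) : A →ₙₐ[ℂ] I.Quot where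
  toFun := I.proj
  map_smul' := I.proj_smul
  map_zero' := I.proj_zero
  map_add' := I.proj_add
  map_mul' := I.proj_mul

theorem proj_eq_iff (I : CStarIdeal A) {a b : A} :
    I.proj a = I.proj b ↔ a - b ∈ I.toSubmodule :=
  Submodule.Quotient.eq _

theorem exists_norm_sub_lt (I : CStarIdeal A) {a : A} {C : ℝ} (h : ‖I.proj a‖ < C) :
    ∃ i ∈ I.toSubmodule, ‖a - i‖ < C := by
  obtain ⟨m, hm, hmC⟩ := Submodule.Quotient.norm_mk_lt (I.proj a) (sub_pos.2 h)
  refine ⟨a - m, I.proj_eq_iff.1 hm.symm, ?_⟩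
  rw [sub_sub_cancel]
  linarith

theorem proj_eval (I : CStarIdeal A) {σ : Type*} (p : NCStarPoly σ) (v : σ → A) :
    I.proj (p.eval v) = p.eval (fun k => I.proj (v k)) :=
  NCStarPoly.map_eval I.projHom I.proj_star p v

theorem proj_eval_elim (I : CStarIdeal A) {r : ℕ} (p : NCStarPoly (Fin r ⊕ ℕ)) (z : Fin r → A)
    (y : ℕ → A) : I.proj (p.eval (Sum.elim z y)) =
      p.eval (Sum.elim (fun k => I.proj (z k)) (fun n => I.proj (y n))) := by
  rw [proj_eval]
  congr 1
  funext k
  cases k <;> rfl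

variable [PartialOrder A] [StarOrderedRing A]

open NCStarPoly Unitization in
/-- Compressing the positive variables by a quasicentral approximate unit of the ideal reduces
the norms of homogeneous polynomials to almost the bounds that hold in the quotient. -/
theorem exists_compression {J r : ℕ} (p : Fin J → NCStarPoly (Fin r ⊕ ℕ)) (d : Fin J → ℕ)
    (hd : ∀ j, 1 ≤ d j) (hp : ∀ j, (p j).IsHomogeneousInFirst (d j))
    (C : Fin J → ℝ) (hC : ∀ j, 0 < C j) (I : CStarIdeal A) (z : Fin r → A) (y : ℕ → A)
    (hz : ∀ k, 0 ≤ z k) (hπ : ∀ j, ‖I.proj ((p j).eval (Sum.elim z y))‖ ≤ C j)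
    {δ : ℝ} (hδ0 : 0 ≤ δ) (hδ1 : δ ≤ 1)
    (hδ : ∀ j, (1 - δ) * ‖(p j).eval (Sum.elim z y)‖ ≤ C j) {η : ℝ} (hη : 0 < η) :
    ∃ z' : Fin r → A, (∀ k, 0 ≤ z' k ∧ z' k ≤ z k ∧ ‖z' k - z k‖ ≤ δ * ‖z k‖ ∧
      z' k - z k ∈ I.toSubmodule) ∧ ∀ j, ‖(p j).eval (Sum.elim z' y)‖ ≤ C j + η := by
  let a : Fin J → A := fun j => (p j).eval (Sum.elim z y)
  have hi : ∀ j, ∃ i ∈ I.toSubmodule, ‖a j - i‖ < C j + η / 3 := fun j =>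
    I.exists_norm_sub_lt ((hπ j).trans_lt (by linarith))
  choose i hiI hi using hi
  let w : Fin r → A := fun k => CFC.sqrt (z k)
  have hw : ∀ k, w k * w k = z k := fun k => CFC.sqrt_mul_sqrt_self _ (hz k)
  have hw0 : ∀ k, 0 ≤ w k := fun k => CFC.sqrt_nonneg _
  -- The two elements `a - i` and `(1 - δ) a` of the convex combination; the unitization supplies `1
  -- - e` and the defects.
  let c : Fin J → Unitization ℂ A := fun j => ((a j - i j : A) : Unitization ℂ A)
  let b : Fin J → Unitization ℂ A := fun j => (((1 - δ) • a j : A) : Unitization ℂ A)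
  let g : StarLetter (Fin r ⊕ ℕ) → A := letterValue (Sum.elim z y)
  obtain ⟨e, heI, he0, he1, heF, heG⟩ := I.exists_quasicentral_seq
    (Sum.elim g (Sum.elim w (Sum.elim (fun j => (star (c j)).snd) (Sum.elim
      (fun j => (star (b j)).snd) (Sum.elim (fun j => (defect (C j + η / 3) (c j)).snd)
        (fun j => (defect (C j + η / 3) (b j)).snd)))))) i hiI
  -- The scalar part of `u` is central, so it is enough that `e n` asymptotically commutes with the
  -- `A`-component.
  have hcomm : ∀ u : Unitization ℂ A,
      Tendsto (fun n => e n * u.snd - u.snd * e n) atTop (𝓝 0) →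
      Tendsto (fun n => (e n : Unitization ℂ A) * u - u * e n) atTop (𝓝 0) := by
    intro u hu
    rw [tendsto_zero_iff_norm_tendsto_zero] at hu ⊢
    refine hu.congr fun n => ?_
    rw [← norm_inr (𝕜 := ℂ)]
    congr 1
    conv_rhs => rw [← inl_fst_add_inr_snd_eq u]
    rw [mul_add, add_mul, inr_mul_inl, inl_mul_inr, ← inr_mul, ← inr_mul, inr_sub]
    abel
  have hE0 : ∀ n, 0 ≤ (e n : Unitization ℂ A) := fun n => inr_nonneg_iff.2 (he0 n)
  have hE1 : ∀ n, ‖(e n : Unitization ℂ A)‖ ≤ 1 := fun n => by rw [norm_inr]; exact he1 n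
  have hE1' : ∀ n, (e n : Unitization ℂ A) ≤ 1 := fun n =>
    (CStarAlgebra.norm_le_one_iff_of_nonneg _ (hE0 n)).1 (hE1 n)
  let q : ℕ → Unitization ℂ A := fun n => 1 - δ • (e n : Unitization ℂ A)
  have hq1 : ∀ n, ‖q n‖ ≤ 1 := by
    intro n
    have h1 : δ • (e n : Unitization ℂ A) ≤ 1 :=
      (smul_le_of_le_one_left (hE0 n) hδ1).trans (hE1' n)
    rw [CStarAlgebra.norm_le_one_iff_of_nonneg _ (sub_nonneg.2 h1)]
    exact sub_le_self _ (smul_nonneg hδ0 (hE0 n))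
  have hqk : ∀ n k, ‖q n ^ k‖ ≤ 1 := fun n k =>
    (norm_pow_le _ _).trans (pow_le_one₀ (norm_nonneg _) (hq1 n))
  let z' : ℕ → Fin r → A := fun n k => z k - δ • (w k * e n * w k)
  have hwew0 : ∀ n k, 0 ≤ w k * e n * w k := fun n k => conjugate_nonneg_of_nonneg (he0 n) (hw0 k)
  have hwew1 : ∀ n k, w k * e n * w k ≤ z k := by
    intro n k
    have := CStarAlgebra.star_left_conjugate_le_norm_smul (a := w k) (.of_nonneg (he0 n))
    rw [(IsSelfAdjoint.of_nonneg (hw0 k)).star_eq, hw] at this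
    exact this.trans (smul_le_of_le_one_left (hz k) (he1 n))
  have hz'0 : ∀ n k, 0 ≤ z' n k := fun n k => sub_nonneg.2
    ((smul_le_of_le_one_left (hwew0 n k) hδ1).trans (hwew1 n k))
  have hz'lim : ∀ k, Tendsto (fun n => ((z' n k : A) : Unitization ℂ A) - q n * z k)
      atTop (𝓝 0) := by
    intro k
    have h1 := ((hcomm (w k) (heF (.inr (.inl k)))).mul_const (w k : Unitization ℂ A)).const_smul δ
    rw [zero_mul, smul_zero] at h1
    refine h1.congr fun n => ?_
    have : (z k : Unitization ℂ A) = w k * w k := by rw [← inr_mul, hw]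
    simp only [z', q, inr_sub, inr_smul, inr_mul, sub_mul, smul_mul_assoc, one_mul, this,
      smul_sub, mul_assoc]
    abel
  have hqg : ∀ ℓ, Tendsto (fun n => q n * (g ℓ : Unitization ℂ A) - g ℓ * q n) atTop (𝓝 0) := by
    intro ℓ
    have h1 := (hcomm (g ℓ) (heF (.inl ℓ))).const_smul (-δ)
    rw [smul_zero] at h1
    refine h1.congr fun n => ?_
    simp only [q, sub_mul, mul_sub, smul_mul_assoc, mul_smul_comm, one_mul, mul_one, neg_smul,
      smul_sub]
    abel
  have hfl : ∀ ℓ, Tendsto (fun n => ((letterValue (Sum.elim (z' n) y) ℓ : A) : Unitization ℂ A)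
      - q n ^ firstWeight ℓ * g ℓ) atTop (𝓝 0) := by
    rintro ((k | m) | (k | m))
    · simpa [letterValue, firstWeight, StarLetter.index, g] using hz'lim k
    · simp [letterValue, firstWeight, StarLetter.index, g]
    -- Positivity matters here: the adjoint letter takes the same value as the variable, so its
    -- factor `q n` is again on the left.
    · have h1 : ∀ n, star (z' n k) = z' n k := fun n => (IsSelfAdjoint.of_nonneg (hz'0 n k)).star_eq
      have h2 : star (z k) = z k := (IsSelfAdjoint.of_nonneg (hz k)).star_eq
      simpa [letterValue, firstWeight, StarLetter.index, g, h1, h2, -inr_star] using hz'lim k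
    · simp [letterValue, firstWeight, StarLetter.index, g]
  have hmap : ∀ (p : NCStarPoly (Fin r ⊕ ℕ)) (f : StarLetter (Fin r ⊕ ℕ) → A),
      subst (fun ℓ => (f ℓ : Unitization ℂ A)) p = (subst f p : A) := fun p f =>
    (map_subst (inrNonUnitalStarAlgHom ℂ A).toNonUnitalAlgHom f p).symm
  have hev : ∀ j, ∀ᶠ n in atTop, ‖(p j).eval (Sum.elim (z' n) y)‖ ≤ C j + η := by
    intro j
    have l1 := tendsto_subst_sub_pow_mul hqk firstWeight hqg hfl
      (fun v hv => (hp j).wordWeight_eq hv)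
    simp only [hmap] at l1
    -- The difference is exactly `-(e n * i j - i j)`.
    have l2 : Tendsto (fun n => q n * (a j : Unitization ℂ A)
        - ((1 - (e n : Unitization ℂ A)) * c j + e n * b j)) atTop (𝓝 0) := by
      have h1 : Tendsto (fun n => ‖-((e n * i j - i j : A) : Unitization ℂ A)‖) atTop (𝓝 0) := by
        simp only [norm_neg, norm_inr]
        exact tendsto_zero_iff_norm_tendsto_zero.1 (heG j)
      refine (tendsto_zero_iff_norm_tendsto_zero.2 h1).congr fun n => ?_
      simp only [q, c, b, inr_sub, inr_smul, inr_mul, sub_mul, mul_sub, one_mul, smul_mul_assoc,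
        mul_smul_comm, sub_smul, one_smul]
      abel
    have l3 := eventually_norm_convex_le hE0 hE1 (M := C j + η / 3) (η := η / 3)
      (c := c j) (b := b j) (by have := hC j; positivity) (by positivity)
      (by rw [norm_inr]; exact (hi j).le)
      (by
        rw [norm_inr, norm_smul, Real.norm_of_nonneg (sub_nonneg.2 hδ1)]
        exact (hδ j).trans (by linarith))
      (hcomm _ (heF (.inr (.inr (.inl j)))))
      (hcomm _ (heF (.inr (.inr (.inr (.inl j))))))
      (hcomm _ (heF (.inr (.inr (.inr (.inr (.inl j)))))))
      (hcomm _ (heF (.inr (.inr (.inr (.inr (.inr j)))))))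
    have hη6 : 0 < η / 6 := by positivity
    filter_upwards [(tendsto_zero_iff_norm_tendsto_zero.1 l1).eventually_le_const hη6,
      (tendsto_zero_iff_norm_tendsto_zero.1 l2).eventually_le_const hη6, l3] with n h1 h2 h3
    -- This is where `d j ≥ 1` enters: one factor `q n` is kept and the others are contractions.
    have hqd : ‖q n ^ d j * (a j : Unitization ℂ A)‖ ≤ ‖q n * (a j : Unitization ℂ A)‖ := by
      obtain ⟨m, hm⟩ := Nat.exists_eq_add_of_le' (hd j)
      rw [hm, pow_succ, mul_assoc]
      refine (norm_mul_le _ _).trans ?_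
      exact mul_le_of_le_one_left (norm_nonneg _) (hqk n m)
    rw [← norm_inr (𝕜 := ℂ)]
    have t1 := norm_le_norm_add_norm_sub' (((p j).eval (Sum.elim (z' n) y) : A) : Unitization ℂ A)
      (q n ^ d j * (a j : Unitization ℂ A))
    have t2 := norm_le_norm_add_norm_sub' (q n * (a j : Unitization ℂ A))
      ((1 - (e n : Unitization ℂ A)) * c j + e n * b j)
    have h1' : ‖(((p j).eval (Sum.elim (z' n) y) : A) : Unitization ℂ A)
      - q n ^ d j * (a j : Unitization ℂ A)‖ ≤ η / 6 := h1
    linarith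
  obtain ⟨n, hn⟩ := (eventually_all.2 hev).exists
  refine ⟨z' n, fun k => ⟨hz'0 n k, sub_le_self _ (smul_nonneg hδ0 (hwew0 n k)), ?_, ?_⟩, hn⟩
  · rw [sub_sub_cancel_left, norm_neg, norm_smul, Real.norm_of_nonneg hδ0]
    gcongr
    exact CStarAlgebra.norm_le_norm_of_nonneg_of_le (hwew0 n k) (hwew1 n k)
  · rw [sub_sub_cancel_left, ← Complex.coe_smul]
    exact I.toSubmodule.neg_mem (I.toSubmodule.smul_mem _
      (I.mul_mem_right' _ (I.mul_mem_left' _ (heI n))))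

end CStarIdeal

/-! ### Iteration and passage to the limit. -/

theorem theorem3p1 {J r : ℕ} (p : Fin J → NCStarPoly (Fin r ⊕ ℕ)) (d : Fin J → ℕ)
    (hd : ∀ j, 1 ≤ d j) (hp : ∀ j, (p j).IsHomogeneousInFirst (d j))
    (C : Fin J → ℝ) (hC : ∀ j, 0 < C j)
    {A : Type*} [NonUnitalCStarAlgebra A] [PartialOrder A] [StarOrderedRing A]
    (I : CStarIdeal A) (x : Fin r → A) (y : ℕ → A) (hx : ∀ k, 0 ≤ x k)
    (hxy : ∀ j, ‖(p j).eval (Sum.elim (fun k => I.proj (x k)) (fun n => I.proj (y n)))‖ ≤ C j) :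
    ∃ z : Fin r → A, (∀ k, 0 ≤ z k ∧ z k ≤ x k) ∧ (∀ k, I.proj (z k) = I.proj (x k)) ∧
      ∀ j, ‖(p j).eval (Sum.elim z y)‖ ≤ C j := by
  obtain ⟨m, hmC, hm⟩ : ∃ m : ℝ, (∀ j, m ≤ C j) ∧ 0 < m :=
    ((eventually_all.2 fun j => (Ioc_mem_nhdsGT (hC j) :
      ∀ᶠ m in 𝓝[>] (0 : ℝ), m ∈ Set.Ioc 0 (C j))).and
      self_mem_nhdsWithin).exists.imp fun m h => ⟨fun j => (h.1 j).2, h.2⟩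
  obtain ⟨E, hE, hE0⟩ : ∃ E : ℝ, (∀ j, ‖(p j).eval (Sum.elim x y)‖ ≤ C j + E) ∧ 0 < E :=
    ((eventually_all.2 fun j => (eventually_ge_atTop (‖(p j).eval (Sum.elim x y)‖ - C j))).and
      (eventually_gt_atTop 0)).exists.imp fun E h => ⟨fun j => by linarith [h.1 j], h.2⟩
  -- `E` bounds the excess at the starting point `x`; the excess is halved at each step.
  let ε : ℕ → ℝ := fun n => E * (1 / 2) ^ n
  have hε : ∀ n, 0 < ε n := fun n => by positivity
  let S : ℕ → (Fin r → A) → Prop := fun n z => (∀ k, 0 ≤ z k ∧ z k ≤ x k ∧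
    I.proj (z k) = I.proj (x k)) ∧ ∀ j, ‖(p j).eval (Sum.elim z y)‖ ≤ C j + ε n
  have step : ∀ n z, S n z → ∃ z', S (n + 1) z' ∧ ∀ k, ‖z' k - z k‖ ≤ ε n / m * ‖x k‖ := by
    rintro n z ⟨hz, hzp⟩
    have hπ : ∀ j, ‖I.proj ((p j).eval (Sum.elim z y))‖ ≤ C j := by
      intro j
      rw [I.proj_eval_elim]
      simpa only [(hz _).2.2] using hxy j
    have hεn := hε n
    -- With this `δ`, `1 - δ = m / (m + ε n)`, and `m ≤ C j` gives `(1 - δ) (C j + ε n) ≤ C j`.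
    -- Moreover `δ ≤ ε n / m`, which makes the displacements summable.
    obtain ⟨z', hz', hz'p⟩ := I.exists_compression p d hd hp C hC z y (fun k => (hz k).1) hπ
      (δ := ε n / (m + ε n)) (by positivity) (by rw [div_le_one (by positivity)]; linarith)
      (by
        intro j
        have h1 : 1 - ε n / (m + ε n) = m / (m + ε n) := by field_simp; ring
        have h2 := hmC j
        rw [h1, div_mul_eq_mul_div, div_le_iff₀ (by positivity)]
        nlinarith [mul_le_mul_of_nonneg_left (hzp j) hm.le]) (hε (n + 1))
    refine ⟨z', ⟨fun k => ⟨(hz' k).1, (hz' k).2.1.trans (hz k).2.1,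
      (I.proj_eq_iff.2 (hz' k).2.2.2).trans (hz k).2.2⟩, hz'p⟩, fun k => ?_⟩
    refine (hz' k).2.2.1.trans ?_
    have h1 : ε n / (m + ε n) ≤ ε n / m := by gcongr; linarith
    have h2 := CStarAlgebra.norm_le_norm_of_nonneg_of_le (hz k).1 (hz k).2.1
    gcongr
  choose! next hnextS hnext using step
  let z : ℕ → Fin r → A := fun n => Nat.rec x next n
  have hS : ∀ n, S n (z n) := by
    intro n
    induction n with
    | zero => exact ⟨fun k => ⟨hx k, le_rfl, rfl⟩, fun j => (hE j).trans_eq (by simp [ε])⟩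
    | succ n ih => exact hnextS n _ ih
  have hlim : ∀ k, ∃ l, Tendsto (fun n => z n k) atTop (𝓝 l) := by
    intro k
    refine cauchySeq_tendsto_of_complete
      (cauchySeq_of_le_geometric (1 / 2) (E / m * ‖x k‖) (by norm_num) fun n => ?_)
    rw [dist_comm, dist_eq_norm]
    refine (hnext n _ (hS n) k).trans (le_of_eq ?_)
    simp only [ε]
    ring
  choose l hl using hlim
  refine ⟨l, fun k => ⟨ge_of_tendsto' (hl k) fun n => ((hS n).1 k).1,
    le_of_tendsto' (hl k) fun n => ((hS n).1 k).2.1⟩, fun k => ?_, fun j => ?_⟩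
  · rw [I.proj_eq_iff]
    exact I.isClosed'.mem_of_tendsto ((hl k).sub_const (x k))
      (.of_forall fun n => I.proj_eq_iff.1 ((hS n).1 k).2.2)
  · have hcont : Continuous fun v : Fin r → A => (p j).eval (Sum.elim v y) := by
      refine NCStarPoly.continuous_eval (p j) fun k => ?_
      cases k with
      | inl k => exact continuous_apply k
      | inr k => exact continuous_const
    have h1 := ((hcont.tendsto l).comp (tendsto_pi_nhds.2 hl)).norm
    have h2 : Tendsto (fun n => C j + ε n) atTop (𝓝 (C j)) := by
      have := (tendsto_pow_atTop_nhds_zero_of_lt_one (r := (1 / 2 : ℝ)) (by norm_num)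
        (by norm_num)).const_mul E
      simpa [ε] using this.const_add (C j)
    exact le_of_tendsto_of_tendsto' h1 h2 fun n => (hS n).2 j
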